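/- Let $X$ be a metrizable space that is locally path-connected and nowhere locally compact (that is, no point of $X$ has a compact neighbourhood). Let $\mathrm{fin}(X)$ be the hyperspace of non-empty finite subsets of $X$ with the Vietoris topology, i.e. the topology generated by the sets $\{A \mid A\subset U\}$ and $\{A\mid A\cap U\neq\emptyset\}$ for $U$ open in $X$. Then $\mathrm{fin}(X)$ has the countable locally finite approximation property: for every open cover $\mathcal U$ of $\mathrm{fin}(X)$ there is a sequence $(f_n)_{n<\omega}$ of continuous maps $f_n:\mathrm{fin}(X)\to\mathrm{fin}(X)$ such that 1. each $f_n$ is $\mathcal U$-close to the identity, i.e. for every $A\in\mathrm{fin}(X)$ some member of $\mathcal U$ contains both $A$ and $f_n(A)$; and 2. the indexed family $\{f_n(\mathrm{fin}(X))\}_{n<\omega}$ is locally finite in $\mathrm{fin}(X)$, i.e. every point of $\mathrm{fin}(X)$ has a neighbourhood that meets $f_n(\mathrm{fin}(X))$ for only finitely many indices $n$. -/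

import Mathlib

/-- The set of non-empty finite subsets of `X`. -/
def FinHyperspace (X : Type*) : Type _ := {A : Set X // A.Finite ∧ A.Nonempty}

/-- The Vietoris topology on the non-empty finite subsets of `X`: the one generated by the sets
`{A | A ⊆ U}` and `{A | (A ∩ U).Nonempty}` for `U` open in `X`, obtained by restricting Mathlib's
Vietoris topology on the set of all subsets. -/
instance FinHyperspace.instTopologicalSpace (X : Type*) [TopologicalSpace X] :
    TopologicalSpace (FinHyperspace X) :=
  TopologicalSpace.induced (fun A : FinHyperspace X => A.1) (TopologicalSpace.vietoris X)

/-- No point of `X` has a compact neighbourhood. -/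
def NowhereLocallyCompact (X : Type*) [TopologicalSpace X] : Prop :=
  ∀ x : X, ∀ K ∈ nhds x, ¬ IsCompact K

/-- `U` is a cover of `Y` by open sets. -/
def IsOpenSetCover {Y : Type*} [TopologicalSpace Y] (U : Set (Set Y)) : Prop :=
  (∀ V ∈ U, IsOpen V) ∧ ⋃₀ U = Set.univ

/-- `f` is `U`-close to `g`: for each `x` some single member of `U` contains both `f x`
and `g x`. -/
def CoverClose {X Y : Type*} (U : Set (Set Y)) (f g : X → Y) : Prop :=
  ∀ x, ∃ V ∈ U, f x ∈ V ∧ g x ∈ V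

/-- The countable locally finite approximation property. Local finiteness is that of the indexed
family of images: every point has a neighbourhood meeting the image of `f n` for only finitely
many indices `n`. -/
def CountableLocallyFiniteApproximation (Y : Type*) [TopologicalSpace Y] : Prop :=
  ∀ U : Set (Set Y), IsOpenSetCover U →
    ∃ f : ℕ → Y → Y, (∀ n, Continuous (f n)) ∧ (∀ n, CoverClose U (f n) id) ∧
      LocallyFinite (fun n => Set.range (f n))

section

open Set Filter Topology Metric

/-! Give `fin(X)` the Hausdorff metric, choose a continuous radius `ε A > 0` fitting the cover, and
let `f_n` add to `A` a finite set `g_n(a, ε A)` inside the ball of radius `ε A` about each `a ∈ A`.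

The maps `g_n` come from `NowhereLocallyCompact.exists_maps_finHyperspace`. Each index `i` of a bump
covering of `X × (0, ∞)` carries a locally finite sequence `z i n`, found near its centre because no
ball has compact closure. Where bumps overlap, short paths joining `z i n` to `z j n` make the
finite sets vary continuously.

Every `g_n(y)` contains some `z i n` with `i` active at `y`, so near a given `y` these sets meet the
terms of one locally finite sequence. `FinHyperspace.locallyFinite_range_enlarge` passes from this
to the images of the `f_n`. -/

/-- The admissible radii at a point form an interval, and a constant works locally, so a partition
of unity glues them. -/
theorem exists_continuous_closedBall_subset_of_openCover {L : Type*} [MetricSpace L]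
    {U : Set (Set L)} (hU : IsOpenSetCover U) :
    ∃ ε : C(L, ℝ), ∀ A, 0 < ε A ∧ ∃ V ∈ U, closedBall A (ε A) ⊆ V := by
  refine exists_continuous_forall_mem_convex_of_local_const
    (t := fun A => {r : ℝ | 0 < r ∧ ∃ V ∈ U, closedBall A r ⊆ V}) (fun A => ?_) (fun A => ?_)
  · refine OrdConnected.convex ⟨?_⟩
    rintro r ⟨hr, -⟩ s ⟨-, V, hV, hs⟩ t ht
    exact ⟨hr.trans_le ht.1, V, hV, (closedBall_subset_closedBall ht.2).trans hs⟩
  · obtain ⟨V, hV, hA⟩ : A ∈ ⋃₀ U := hU.2 ▸ mem_univ A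
    obtain ⟨r, hr, hrV⟩ := Metric.isOpen_iff.1 (hU.1 V hV) A hA
    refine ⟨r / 2, ?_⟩
    filter_upwards [ball_mem_nhds A (half_pos hr)] with B hB
    refine ⟨half_pos hr, V, hV, fun C hC => hrV ?_⟩
    rw [mem_ball] at *
    rw [mem_closedBall] at hC
    linarith [dist_triangle C B A]

/-! ### Vietoris continuity, enlargements and the Hausdorff metric -/

namespace FinHyperspace

variable {X Y T : Type*} [TopologicalSpace X] [TopologicalSpace Y] [TopologicalSpace T]

theorem isOpen_setOf_subset {U : Set X} (hU : IsOpen U) :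
    IsOpen {A : FinHyperspace X | A.1 ⊆ U} :=
  isOpen_induced (t := TopologicalSpace.vietoris X) hU.powerset_vietoris

theorem isOpen_setOf_inter_nonempty {U : Set X} (hU : IsOpen U) :
    IsOpen {A : FinHyperspace X | (A.1 ∩ U).Nonempty} :=
  isOpen_induced (t := TopologicalSpace.vietoris X)
    (TopologicalSpace.vietoris.isOpen_inter_nonempty_of_isOpen hU)

theorem continuous_of_eventually {f : Y → FinHyperspace X}
    (hsub : ∀ y U, IsOpen U → (f y).1 ⊆ U → ∀ᶠ y' in 𝓝 y, (f y').1 ⊆ U)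
    (hmeet : ∀ y U, IsOpen U → ∀ p ∈ (f y).1, p ∈ U → ∀ᶠ y' in 𝓝 y, ((f y').1 ∩ U).Nonempty) :
    Continuous f := by
  refine continuous_induced_rng.2 (continuous_generateFrom_iff.2 ?_)
  rintro _ (⟨U, hU, rfl⟩ | ⟨U, hU, rfl⟩)
  · exact isOpen_iff_mem_nhds.2 fun y hy => hsub y U hU hy
  · refine isOpen_iff_mem_nhds.2 fun y hy => ?_
    obtain ⟨p, hp, hpU⟩ := hy
    exact hmeet y U hU p hp hpU

/-- The finite set `A` enlarged by the finite sets attached to its points. -/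
def enlarge (g : X × T → FinHyperspace X) (t : T) (A : FinHyperspace X) : FinHyperspace X :=
  ⟨A.1 ∪ ⋃ a ∈ A.1, (g (a, t)).1, A.2.1.union (A.2.1.biUnion fun a _ => (g (a, t)).2.1),
    A.2.2.mono subset_union_left⟩

theorem continuous_enlarge {g : X × T → FinHyperspace X} (hg : Continuous g)
    {ε : FinHyperspace X → T} (hε : Continuous ε) :
    Continuous fun A => enlarge g (ε A) A := by
  refine continuous_of_eventually (fun A U hU hA => ?_) (fun A U hU p hp hpU => ?_)
  · have key : ∀ a ∈ A.1, ∃ N : Set X, IsOpen N ∧ a ∈ N ∧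
        ∀ᶠ B in 𝓝 A, ∀ b ∈ N, (g (b, ε B)).1 ⊆ U := by
      intro a ha
      have h1 : ∀ᶠ q in 𝓝 (a, ε A), (g q).1 ⊆ U :=
        hg.continuousAt.eventually ((isOpen_setOf_subset hU).mem_nhds
          (show (g (a, ε A)).1 ⊆ U from fun q hq => hA (Or.inr (mem_biUnion ha hq))))
      rw [nhds_prod_eq, eventually_prod_iff] at h1
      obtain ⟨P, hP, Q, hQ, hPQ⟩ := h1
      obtain ⟨N, hNP, hN, haN⟩ := eventually_nhds_iff.1 hP
      refine ⟨N, hN, haN, ?_⟩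
      filter_upwards [hε.continuousAt.eventually hQ] with B hB b hb
      exact hPQ (hNP b hb) hB
    choose! N hN haN hev using key
    have h2 : ∀ᶠ B in 𝓝 A, B.1 ⊆ U ∩ ⋃ a ∈ A.1, N a :=
      (isOpen_setOf_subset (hU.inter (isOpen_biUnion hN))).mem_nhds
        (fun a ha => ⟨hA (Or.inl ha), mem_biUnion ha (haN a ha)⟩)
    filter_upwards [h2, (eventually_all_finite A.2.1).2 hev] with B hB hB'
    refine union_subset (hB.trans inter_subset_left) (iUnion₂_subset fun b hb => ?_)
    obtain ⟨a, ha, hba⟩ := mem_iUnion₂.1 (hB hb).2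
    exact hB' a ha b hba
  · rcases hp with hp | hp
    · filter_upwards [(isOpen_setOf_inter_nonempty hU).mem_nhds (show (A.1 ∩ U).Nonempty from
        ⟨p, hp, hpU⟩)] with B hB
      exact hB.mono (inter_subset_inter_left _ subset_union_left)
    · obtain ⟨a, ha, hpa⟩ := mem_iUnion₂.1 hp
      have h1 : ∀ᶠ q in 𝓝 (a, ε A), ((g q).1 ∩ U).Nonempty :=
        hg.continuousAt.eventually ((isOpen_setOf_inter_nonempty hU).mem_nhds
          (show ((g (a, ε A)).1 ∩ U).Nonempty from ⟨p, hpa, hpU⟩))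
      rw [nhds_prod_eq, eventually_prod_iff] at h1
      obtain ⟨P, hP, Q, hQ, hPQ⟩ := h1
      obtain ⟨N, hNP, hN, haN⟩ := eventually_nhds_iff.1 hP
      filter_upwards [hε.continuousAt.eventually hQ, (isOpen_setOf_inter_nonempty hN).mem_nhds
        (show (A.1 ∩ N).Nonempty from ⟨a, ha, haN⟩)] with B hB hBN
      obtain ⟨b, hb, hbN⟩ := hBN
      obtain ⟨q, hq, hqU⟩ := hPQ (hNP b hbN) hB
      exact ⟨q, Or.inr (mem_biUnion hb hq), hqU⟩

/-- A non-empty finite set as a non-empty compact set. -/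
def toNonemptyCompacts (A : FinHyperspace X) : TopologicalSpace.NonemptyCompacts X :=
  ⟨⟨A.1, A.2.1.isCompact⟩, A.2.2⟩

theorem isEmbedding_toNonemptyCompacts : IsEmbedding (toNonemptyCompacts (X := X)) := by
  let := TopologicalSpace.vietoris X
  have h : IsEmbedding (fun A : FinHyperspace X => A.1) := ⟨⟨rfl⟩, Subtype.val_injective⟩
  exact TopologicalSpace.NonemptyCompacts.isEmbedding_coe.of_comp_iff.1 h

/-- The Hausdorff metric. -/
noncomputable abbrev metricSpace (X : Type*) [MetricSpace X] : MetricSpace (FinHyperspace X) :=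
  isEmbedding_toNonemptyCompacts.comapMetricSpace toNonemptyCompacts

attribute [local instance] metricSpace

theorem dist_le_of_forall {X : Type*} [MetricSpace X] {A B : FinHyperspace X} {r : ℝ}
    (hr : 0 ≤ r) (hA : ∀ a ∈ A.1, ∃ b ∈ B.1, dist a b ≤ r)
    (hB : ∀ b ∈ B.1, ∃ a ∈ A.1, dist b a ≤ r) : dist A B ≤ r :=
  hausdorffDist_le_of_mem_dist hr hA hB

theorem exists_dist_lt {X : Type*} [MetricSpace X] {A B : FinHyperspace X} {r : ℝ}
    (h : dist A B < r) {a : X} (ha : a ∈ A.1) : ∃ b ∈ B.1, dist a b < r :=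
  exists_dist_lt_of_hausdorffDist_lt ha h
    (hausdorffEDist_ne_top_of_nonempty_of_bounded A.2.2 B.2.2 A.2.1.isBounded B.2.1.isBounded)

end FinHyperspace

/-- The path parameter is `(2 * u i y - 1) * (2 * u j y)`: it vanishes both where `i` becomes
active and where `j` disappears, and is at least `1` where `u i = 1` and `u j ≥ 1 / 2`. -/
theorem BumpCovering.exists_continuous_finHyperspace {X Y ι : Type*} [TopologicalSpace X]
    [TopologicalSpace Y] (u : BumpCovering ι Y) (z : ι → X) (γ : ι → ι → ℝ → X)
    (hγ : ∀ i j, Continuous (γ i j)) (h0 : ∀ i j, ∀ s ≤ 0, γ i j s = z i)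
    (h1 : ∀ i j, (∃ y, u i y ≠ 0 ∧ u j y ≠ 0) → ∀ s, 1 ≤ s → γ i j s = z j) :
    ∃ g : Y → FinHyperspace X, Continuous g ∧ (∀ y, ∃ i, u i y = 1 ∧ z i ∈ (g y).1) ∧
      ∀ y, ∀ p ∈ (g y).1, ∃ i j s, u i y ≠ 0 ∧ u j y ≠ 0 ∧ p = γ i j s := by
  let s : ι → ι → Y → ℝ := fun i j y => (2 * u i y - 1) * (2 * u j y)
  have hs : ∀ i j, Continuous (s i j) := fun i j => by fun_prop
  let G : Y → Set X := fun y =>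
    {p | ∃ i, 1 / 2 < u i y ∧ (p = z i ∨ ∃ j, u j y ≠ 0 ∧ p = γ i j (s i j y))}
  have hone : ∀ y, ∃ i, u i y = 1 := fun y =>
    ⟨u.ind y (mem_univ y), u.ind_apply y (mem_univ y)⟩
  have hfin : ∀ y, (G y).Finite := by
    intro y
    have hF := u.point_finite y
    refine ((hF.image z).union (hF.image2 (fun i j => γ i j (s i j y)) hF)).subset ?_
    rintro p ⟨i, hi, rfl | ⟨j, hj, rfl⟩⟩
    · exact Or.inl ⟨i, (by linarith : (0 : ℝ) < u i y).ne', rfl⟩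
    · exact Or.inr ⟨i, (by linarith : (0 : ℝ) < u i y).ne', j, hj, rfl⟩
  -- If `u k y = 1`, the path from `z k` to `z i` has reached its end once `u i y ≥ 1 / 2`. Hence `z
  -- i` is already present at the threshold, where the strict inequality in `G` does not yet supply
  -- it, and no point appears abruptly.
  have hz : ∀ y i, 1 / 2 ≤ u i y → z i ∈ G y := by
    intro y i hi
    obtain ⟨k, hk⟩ := hone y
    have hi' : u i y ≠ 0 := (by linarith : (0 : ℝ) < u i y).ne'
    refine ⟨k, by rw [hk]; norm_num, Or.inr ⟨i, hi', ?_⟩⟩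
    refine (h1 k i ⟨y, by rw [hk]; exact one_ne_zero, hi'⟩ _ ?_).symm
    simp only [s, hk]
    linarith
  have hmem : ∀ y i j, 1 / 2 ≤ u i y → γ i j (s i j y) ∈ G y := by
    intro y i j hi
    by_cases hj : u j y = 0
    · rw [h0 i j _ (by simp [s, hj])]
      exact hz y i hi
    rcases hi.eq_or_lt with hi' | hi'
    · rw [h0 i j _ (by simp [s, ← hi'])]
      exact hz y i hi
    · exact ⟨i, hi', Or.inr ⟨j, hj, rfl⟩⟩
  refine ⟨fun y => ⟨G y, hfin y, ?_⟩, FinHyperspace.continuous_of_eventually ?_ ?_, ?_, ?_⟩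
  · obtain ⟨i, hi⟩ := hone y
    exact ⟨z i, hz y i (by rw [hi]; norm_num)⟩
  · intro y U hU (hyU : G y ⊆ U)
    obtain ⟨t, ht, hJ⟩ := u.locallyFinite y
    have key : ∀ i ∈ {i | (Function.support (u i) ∩ t).Nonempty},
        ∀ j ∈ {i | (Function.support (u i) ∩ t).Nonempty},
        ∀ᶠ y' in 𝓝 y, 1 / 2 < u i y' → z i ∈ U ∧ γ i j (s i j y') ∈ U := by
      intro i _ j _
      rcases lt_or_ge (u i y) (1 / 2) with hi | hi
      · filter_upwards [(u i).continuous.continuousAt.eventually (gt_mem_nhds hi)] with y' h1 h2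
        exact absurd h1 h2.not_gt
      · filter_upwards [((hγ i j).comp (hs i j)).continuousAt.eventually
          (hU.mem_nhds (hyU (hmem y i j hi)))] with y' h _
        exact ⟨hyU (hz y i hi), h⟩
    filter_upwards [ht, (eventually_all_finite hJ).2 fun i hi =>
      (eventually_all_finite hJ).2 (key i hi)] with y' hy't hy'
    rintro p ⟨i, hi, hp⟩
    have hiJ : (Function.support (u i) ∩ t).Nonempty :=
      ⟨y', (by linarith : (0 : ℝ) < u i y').ne', hy't⟩
    rcases hp with rfl | ⟨j, hj, rfl⟩
    · exact (hy' i hiJ i hiJ hi).1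
    · exact (hy' i hiJ j ⟨y', hj, hy't⟩ hi).2
  · rintro y U hU p ⟨i, hi, hp⟩ hpU
    have hi' := (u i).continuous.continuousAt.eventually (lt_mem_nhds hi)
    rcases hp with rfl | ⟨j, hj, rfl⟩
    · filter_upwards [hi'] with y' h
      exact ⟨z i, ⟨i, h, Or.inl rfl⟩, hpU⟩
    · filter_upwards [hi', (u j).continuous.continuousAt.eventually_ne hj,
        ((hγ i j).comp (hs i j)).continuousAt.eventually (hU.mem_nhds hpU)] with y' h h' h''
      exact ⟨_, ⟨i, h, Or.inr ⟨j, h', rfl⟩⟩, h''⟩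
  · intro y
    obtain ⟨i, hi⟩ := hone y
    exact ⟨i, hi, hz y i (by rw [hi]; norm_num)⟩
  · rintro y p ⟨i, hi, hp⟩
    have hi' : u i y ≠ 0 := (by linarith : (0 : ℝ) < u i y).ne'
    rcases hp with rfl | ⟨j, hj, rfl⟩
    · exact ⟨i, i, 0, hi', hi', (h0 i i 0 le_rfl).symm⟩
    · exact ⟨i, j, _, hi', hj, rfl⟩

/-! ### Small maps into the hyperspace from local path-connectedness and non-compactness -/

theorem exists_forall_ball_joinedIn {X : Type*} [MetricSpace X] [LocallyPathConnectedSpace X]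
    (x : X) {r : ℝ} (hr : 0 < r) :
    ∃ δ, 0 < δ ∧ δ ≤ r ∧ ∀ p ∈ ball x δ, ∀ q ∈ ball x δ, JoinedIn (ball x r) p q := by
  obtain ⟨δ, hδ, h⟩ := Metric.mem_nhds_iff.1 (pathComponentIn_mem_nhds (ball_mem_nhds x hr))
  refine ⟨min δ r, lt_min hδ hr, min_le_right _ _, fun p hp q hq => ?_⟩
  have hp' : JoinedIn (ball x r) x p := h (ball_subset_ball (min_le_left _ _) hp)
  have hq' : JoinedIn (ball x r) x q := h (ball_subset_ball (min_le_left _ _) hq)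
  exact hp'.symm.trans hq'

/-- A closed ball is not sequentially compact. A sequence in it without convergent subsequence has
no cluster point, which is local finiteness. -/
theorem NowhereLocallyCompact.exists_locallyFinite_seq {X : Type*} [MetricSpace X]
    (hX : NowhereLocallyCompact X) (x : X) {r : ℝ} (hr : 0 < r) :
    ∃ z : ℕ → X, (∀ n, z n ∈ ball x r) ∧ LocallyFinite fun n => ({z n} : Set X) := by
  have hK : ¬ IsSeqCompact (closedBall x (r / 2)) := fun h =>
    hX x _ (closedBall_mem_nhds x (half_pos hr)) h.isCompact
  simp only [IsSeqCompact] at hK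
  push Not at hK
  obtain ⟨z, hz, hz'⟩ := hK
  refine ⟨z, fun n => closedBall_subset_ball (half_lt_self hr) (hz n), ?_⟩
  by_contra hlf
  simp only [LocallyFinite, not_forall, not_exists, not_and] at hlf
  obtain ⟨a, ha⟩ := hlf
  have hcl : MapClusterPt a atTop z := by
    refine mapClusterPt_iff_frequently.2 fun s hs => Nat.frequently_atTop_iff_infinite.2 ?_
    simpa using ha s hs
  obtain ⟨ψ, hψ, hlim⟩ := hcl.tendsto_subseq
  exact hz' a (isClosed_closedBall.mem_of_tendsto hlim (Eventually.of_forall fun n => hz _))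
    ψ hψ hlim

theorem LocallyFinite.biUnion_of_finite {X ι κ : Type*} [TopologicalSpace X] {J : Set ι}
    (hJ : J.Finite) {Z : ι → κ → Set X} (hZ : ∀ i ∈ J, LocallyFinite (Z i)) :
    LocallyFinite fun n => ⋃ i ∈ J, Z i n := by
  intro x
  choose! t ht hfin using fun i hi => hZ i hi x
  refine ⟨⋂ i ∈ J, t i, (biInter_mem hJ).2 ht, (hJ.biUnion hfin).subset ?_⟩
  rintro n ⟨p, hp, hpt⟩
  obtain ⟨i, hi, hpi⟩ := mem_iUnion₂.1 hp
  exact mem_biUnion hi ⟨p, hpi, mem_iInter₂.1 hpt i hi⟩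

/-- The paths need not be locally finite in `n`: it is enough that each value contains some `z i n`,
with `i` among the finitely many indices active near `y`. -/
theorem NowhereLocallyCompact.exists_maps_finHyperspace {X Y : Type*} [MetricSpace X]
    [LocallyPathConnectedSpace X] (hX : NowhereLocallyCompact X) [TopologicalSpace Y] [T2Space Y]
    [ParacompactSpace Y] (c : C(Y, X)) (ρ : C(Y, ℝ)) (hρ : ∀ y, 0 < ρ y) :
    ∃ g : ℕ → Y → FinHyperspace X, (∀ n, Continuous (g n)) ∧
      (∀ n y, (g n y).1 ⊆ ball (c y) (ρ y)) ∧
      ∀ y, ∃ W ∈ 𝓝 y, ∃ Z : ℕ → Set X, LocallyFinite Z ∧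
        ∀ n, ∀ y' ∈ W, ((g n y').1 ∩ Z n).Nonempty := by
  choose δ hδ hδr hjoin using fun y =>
    exists_forall_ball_joinedIn (c y) (show 0 < ρ y / 8 by linarith [hρ y])
  choose z hzball hzlf using fun y =>
    hX.exists_locallyFinite_seq (c y) (show 0 < δ y / 3 by linarith [hδ y])
  -- For `i`, `j` active at a common point and `δ j ≤ δ i`, three thirds put `z j n` within `δ i` of
  -- `c i`, so a path joins it to `z i n` inside the ball of radius `ρ i / 8`. The bound on `ρ`
  -- keeps that ball inside the one prescribed at the common point.
  let N : Y → Set Y := fun y => {y' | dist (c y') (c y) < δ y / 3 ∧ ρ y / 2 < ρ y'}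
  have hNo : ∀ y, IsOpen (N y) := fun y =>
    (isOpen_lt (c.continuous.dist continuous_const) continuous_const).inter
      (isOpen_lt continuous_const ρ.continuous)
  have hyN : ∀ y, y ∈ N y := fun y =>
    ⟨by rw [dist_self]; linarith [hδ y], half_lt_self (hρ y)⟩
  obtain ⟨u, hu⟩ := BumpCovering.exists_isSubordinate isClosed_univ N hNo
    fun y _ => mem_iUnion.2 ⟨y, hyN y⟩
  have huN : ∀ i y, u i y ≠ 0 → y ∈ N i := fun i y h => hu i (subset_tsupport _ h)
  have hball : ∀ k y, u k y ≠ 0 → ball (c k) (ρ k / 8) ⊆ ball (c y) (ρ y) := by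
    intro k y hk p hp
    obtain ⟨h1, h2⟩ := huN k y hk
    rw [mem_ball] at *
    linarith [dist_triangle_right p (c y) (c k), hδr k, hρ k]
  have hnear : ∀ i j y n, u i y ≠ 0 → u j y ≠ 0 → δ j ≤ δ i → z j n ∈ ball (c i) (δ i) := by
    intro i j y n hi hj hij
    have h1 := (huN i y hi).1
    have h2 := (huN j y hj).1
    have h3 := hzball j n
    rw [mem_ball] at *
    linarith [dist_triangle (z j n) (c j) (c i), dist_triangle_left (c j) (c i) (c y)]
  have hself : ∀ i n, z i n ∈ ball (c i) (δ i) := fun i n =>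
    ball_subset_ball (by linarith [hδ i]) (hzball i n)
  have hpath : ∀ n i j, ∃ γ : ℝ → X, Continuous γ ∧ (∀ s ≤ 0, γ s = z i n) ∧
      ((∃ y, u i y ≠ 0 ∧ u j y ≠ 0) → ∀ s, 1 ≤ s → γ s = z j n) ∧
      ∀ y, u i y ≠ 0 → u j y ≠ 0 → ∀ s, γ s ∈ ball (c y) (ρ y) := by
    intro n i j
    by_cases hij : ∃ y, u i y ≠ 0 ∧ u j y ≠ 0
    · obtain ⟨y, hi, hj⟩ := hij
      obtain ⟨k, hk, hJ⟩ : ∃ k, (k = i ∨ k = j) ∧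
          JoinedIn (ball (c k) (ρ k / 8)) (z i n) (z j n) := by
        rcases le_total (δ j) (δ i) with h | h
        · exact ⟨i, Or.inl rfl, hjoin i _ (hself i n) _ (hnear i j y n hi hj h)⟩
        · exact ⟨j, Or.inr rfl, hjoin j _ (hnear j i y n hj hi h) _ (hself j n)⟩
      refine ⟨hJ.somePath.extend, hJ.somePath.continuous_extend,
        fun s hs => hJ.somePath.extend_of_le_zero hs,
        fun _ s hs => hJ.somePath.extend_of_one_le hs, fun y' hi' hj' s => ?_⟩
      refine hball k y' (by rcases hk with rfl | rfl <;> assumption) ?_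
      obtain ⟨t, ht⟩ : hJ.somePath.extend s ∈ range hJ.somePath := by
        rw [← Path.extend_range]; exact mem_range_self s
      rw [← ht]
      exact hJ.somePath_mem t
    · exact ⟨fun _ => z i n, continuous_const, fun _ _ => rfl, fun h => absurd h hij,
        fun y hi hj => absurd ⟨y, hi, hj⟩ hij⟩
  choose γ hγ h0 h1 hsmall using hpath
  choose g hg hgz hgγ using fun n =>
    u.exists_continuous_finHyperspace (fun i => z i n) (γ n) (hγ n) (h0 n) (h1 n)
  refine ⟨g, hg, fun n y p hp => ?_, fun y => ?_⟩
  · obtain ⟨i, j, s, hi, hj, rfl⟩ := hgγ n y p hp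
    exact hsmall n i j y hi hj s
  · obtain ⟨W, hW, hJ⟩ := u.locallyFinite y
    refine ⟨W, hW, _, LocallyFinite.biUnion_of_finite hJ fun i _ => hzlf i, fun n y' hy' => ?_⟩
    obtain ⟨i, hi, hiz⟩ := hgz n y'
    exact ⟨z i n, hiz, mem_biUnion (show i ∈ {i | (Function.support (u i) ∩ W).Nonempty} from
      ⟨y', by rw [Function.mem_support, hi]; exact one_ne_zero, hy'⟩) rfl⟩

/-! ### Closeness and local finiteness of the enlargements -/

namespace FinHyperspace

attribute [local instance] metricSpace

variable {X T : Type*} [MetricSpace X]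

theorem enlarge_mem_closedBall {g : X × T → FinHyperspace X} {t : T} {A : FinHyperspace X} {r : ℝ}
    (hr : 0 ≤ r) (hg : ∀ a ∈ A.1, (g (a, t)).1 ⊆ ball a r) :
    enlarge g t A ∈ closedBall A r := by
  refine mem_closedBall.2 (dist_le_of_forall hr ?_ fun a ha => ⟨a, Or.inl ha, by simpa⟩)
  rintro p (hp | hp)
  · exact ⟨p, hp, by simpa⟩
  · obtain ⟨a, ha, hpa⟩ := mem_iUnion₂.1 hp
    exact ⟨a, ha, (hg a ha hpa).le⟩

/-- An enlargement contains the original `A'`, so if it is close to `B` then `A'` is close to a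
non-empty subset of `B`. There are only finitely many such subsets, and the union of their sequences
`Z` is still locally finite. -/
theorem locallyFinite_range_enlarge [TopologicalSpace T] {g : ℕ → X × T → FinHyperspace X}
    {ε : FinHyperspace X → T} (hε : Continuous ε)
    (hg : ∀ y, ∃ W ∈ 𝓝 y, ∃ Z : ℕ → Set X, LocallyFinite Z ∧
      ∀ n, ∀ y' ∈ W, ((g n y').1 ∩ Z n).Nonempty) :
    LocallyFinite fun n => range fun A => enlarge (g n) (ε A) A := by
  have key : ∀ A : FinHyperspace X, ∃ r > 0, ∃ Z : ℕ → Set X, LocallyFinite Z ∧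
      ∀ A', dist A' A < r → ∀ n, ((enlarge (g n) (ε A') A').1 ∩ Z n).Nonempty := by
    intro A
    obtain ⟨a, ha⟩ := A.2.2
    obtain ⟨W, hW, Z, hZ, hWZ⟩ := hg (a, ε A)
    obtain ⟨N, hN, M, hM, hNM⟩ := mem_nhds_prod_iff.1 hW
    obtain ⟨s, hs, hsN⟩ := Metric.mem_nhds_iff.1 hN
    obtain ⟨s', hs', hsM⟩ := Metric.mem_nhds_iff.1 (hε.continuousAt hM)
    refine ⟨min s s', lt_min hs hs', Z, hZ, fun A' hA' n => ?_⟩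
    obtain ⟨a', ha', haa'⟩ :=
      exists_dist_lt (dist_comm A' A ▸ hA'.trans_le (min_le_left _ _)) ha
    obtain ⟨p, hp, hpZ⟩ := hWZ n (a', ε A') (hNM ⟨hsN (mem_ball'.2 haa'),
      hsM (mem_ball.2 (hA'.trans_le (min_le_right _ _)))⟩)
    exact ⟨p, Or.inr (mem_biUnion ha' hp), hpZ⟩
  choose r hr Z hZ hrZ using key
  intro B
  have hS : {A : FinHyperspace X | A.1 ⊆ B.1}.Finite :=
    B.2.1.finite_subsets.preimage Subtype.val_injective.injOn
  have hlf := LocallyFinite.biUnion_of_finite hS fun A _ => hZ A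
  choose t ht hfin using hlf
  obtain ⟨r₀, hr₀S, hr₀⟩ : ∃ r₀, (∀ A ∈ {A : FinHyperspace X | A.1 ⊆ B.1}, r₀ < r A) ∧ 0 < r₀ :=
    (((eventually_all_finite hS).2 fun A _ => nhdsWithin_le_nhds (gt_mem_nhds (hr A))).and
      (self_mem_nhdsWithin : ∀ᶠ x in 𝓝[>] (0 : ℝ), 0 < x)).exists
  have hU : {B' : FinHyperspace X | B'.1 ⊆ ⋃ b ∈ B.1, interior (t b)} ∈ 𝓝 B :=
    (isOpen_setOf_subset (isOpen_biUnion fun _ _ => isOpen_interior)).mem_nhds fun b hb =>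
      mem_biUnion hb (mem_interior_iff_mem_nhds.2 (ht b))
  refine ⟨_, inter_mem hU (ball_mem_nhds B hr₀), (B.2.1.biUnion fun b _ => hfin b).subset ?_⟩
  rintro n ⟨_, ⟨A', rfl⟩, hsub, hdist⟩
  have hnear : ∀ a' ∈ A'.1, ∃ b ∈ B.1, dist a' b < r₀ := fun a' ha' =>
    exists_dist_lt hdist (Or.inl ha')
  -- `A'` need not be close to `B` itself, since points of `B` may be approximated only by added
  -- points; these are discarded.
  let A : FinHyperspace X := ⟨{b ∈ B.1 | ∃ a' ∈ A'.1, dist a' b < r₀},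
    B.2.1.subset fun _ h => h.1, by
      obtain ⟨a', ha'⟩ := A'.2.2
      obtain ⟨b, hb, hab⟩ := hnear a' ha'
      exact ⟨b, hb, a', ha', hab⟩⟩
  have hAS : A.1 ⊆ B.1 := fun _ h => h.1
  have hAA' : dist A' A ≤ r₀ := by
    refine dist_le_of_forall hr₀.le (fun a' ha' => ?_) ?_
    · obtain ⟨b, hb, hab⟩ := hnear a' ha'
      exact ⟨b, ⟨hb, a', ha', hab⟩, hab.le⟩
    · rintro b ⟨-, a', ha', hab⟩
      exact ⟨a', ha', by rw [dist_comm]; exact hab.le⟩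
  obtain ⟨p, hp, hpZ⟩ := hrZ A A' (hAA'.trans_lt (hr₀S A hAS)) n
  obtain ⟨b, hb, hpb⟩ := mem_iUnion₂.1 (hsub hp)
  exact mem_biUnion hb ⟨p, mem_biUnion (show A ∈ {A : FinHyperspace X | A.1 ⊆ B.1} from hAS) hpZ,
    interior_subset hpb⟩

end FinHyperspace
end

theorem proposition6p2 (X : Type*) [TopologicalSpace X] [TopologicalSpace.MetrizableSpace X]
    [LocallyPathConnectedSpace X] (hX : NowhereLocallyCompact X) :
    CountableLocallyFiniteApproximation (FinHyperspace X) := by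
  let := TopologicalSpace.metrizableSpaceMetric X
  let := FinHyperspace.metricSpace X
  intro U hU
  obtain ⟨ε, hε⟩ := exists_continuous_closedBall_subset_of_openCover hU
  -- The radius depends on the whole set `A`, not on `a ∈ A`, so it enters `g` as a second, positive
  -- variable.
  let ε' : FinHyperspace X → {t : ℝ // 0 < t} := fun A => ⟨ε A, (hε A).1⟩
  have hε' : Continuous ε' := ε.continuous.subtype_mk _
  obtain ⟨g, hg, hgball, hglf⟩ := hX.exists_maps_finHyperspace (Y := X × {t : ℝ // 0 < t})
    ⟨Prod.fst, continuous_fst⟩ ⟨fun y => y.2, by fun_prop⟩ fun y => y.2.2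
  refine ⟨fun n A => FinHyperspace.enlarge (g n) (ε' A) A,
    fun n => FinHyperspace.continuous_enlarge (hg n) hε', fun n A => ?_,
    FinHyperspace.locallyFinite_range_enlarge hε' hglf⟩
  obtain ⟨hpos, V, hV, hAV⟩ := hε A
  exact ⟨V, hV, hAV (FinHyperspace.enlarge_mem_closedBall hpos.le fun a _ => hgball n (a, ε' A)),
    hAV (Metric.mem_closedBall_self hpos.le)⟩
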